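/- Let $h:\mathbb R^2\to\mathbb R$ be $C^2$ with $h(x+1,x'+1)=h(x,x')$ and, for some constant $c>0$, $h_{12}\le -c$ everywhere (subscripts denote partial derivatives). For a tilt $F$ consider on sequences $\mathbf x=(x_n)_{n\in\mathbb Z}$ the tilted Frenkel--Kontorova gradient flow $\dot x_n=-h_2(x_{n-1},x_n)-h_1(x_n,x_{n+1})+F$; for a sequence $\mathbf z$, $\dot{\mathbf z}$ denotes the right-hand side evaluated at $\mathbf z$, and $\mathbf z$ is an equilibrium if $\dot{\mathbf z}=\mathbf 0$. Order sequences componentwise, $\mathbf x<\mathbf y$ meaning $\mathbf x\le\mathbf y$ and $\mathbf x\neq\mathbf y$; let $(T_{qp}\mathbf x)_n=x_{n-q}+p$ for $p,q\in\mathbb Z$; and say that $\mathbf x$ has mean spacing $\omega$ if $(x_n-x_0)/n\to\omega$ as $n\to\pm\infty$. Let $\mathcal X$ be the space of sequences with $\|\mathbf x\|=\sum_n2^{-|n|}|x_n|<\infty$. *Depinning force.* The width of $\mathbf x$ is $\sup_{m\in\mathbb Z}(n^+(m)-n^-(m))$, where $n^-(m)=\max\{n: T_{mn}\mathbf x\le\mathbf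 x\}$ and $n^+(m)=\min\{n:T_{mn}\mathbf x\ge\mathbf x\}$. Let $\mathcal X^1_\omega$ be the set of $\mathbf x\in\mathcal X$ with $(x_n-n\omega)_n$ bounded and width at most $1$. Let $\bar\nu(\omega,F)$ be the average velocity, i.e. the common limit of $\frac1{t(m-k)}\int_0^t\sum_{n=k}^{m-1}\dot x_n(s)\,ds$, as $m-k\to\infty$ and $t\to+\infty$, along forward orbits $\mathbf x(\cdot)$ of the flow in $\mathcal X^1_\omega$. Put $F_d(\omega)=\sup\{F\ge0:\bar\nu(\omega,F)=0\}$ and $F_d(p/q+)=\limsup_{\omega\searrow p/q}F_d(\omega)$. *IOCs.* An ordered circle is the image $\ell$ of a continuous map $\tau:\mathbb R\to\mathcal X$ with $\tau(s_1)<\tau(s_2)$ for $s_1<s_2$ and $\tau(s+1)=\tau(s)+\mathbf 1$. It is an invariant ordered circle (IOC) for the tilt $F$ if $T_{qp}\ell=\ell$ for all $q,p\in\mathbb Z$ and $\ell$ is invariant under the gradient flow with tilt $F$ for all times $t\in\mathbb R$. Let $p\in\mathbb Z$, $q\ge1$ be coprime. An IOC $\ell$ is of type $p/q+$ if every $\mathbf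 x\in\ell$ has mean spacing $p/q$ and satisfies $T_{qp}\mathbf x\le\mathbf x$, and some $\mathbf x\in\ell$ has $T_{qp}\mathbf x\ne\mathbf x$. An equilibrium $\mathbf x$ is of type $p/q+$ if it has mean spacing $p/q$ and $T_{qp}\mathbf x<\mathbf x$. **Theorem.** Let $F_d(p/q+)\le F<F_d(p/q)$, and let $\ell_F$ be an IOC of type $p/q+$ for the tilt $F$ such that $\dot{\mathbf z}\ge\mathbf 0$ for every $\mathbf z\in\ell_F$. Then every equilibrium $\mathbf x^*\in\ell_F$ of type $p/q+$ is degenerate: the formula $$(A\eta)_i=\alpha_i\eta_{i-1}+\beta_i\eta_i+\alpha_{i+1}\eta_{i+1},\qquad \alpha_i=-h_{12}(x^*_{i-1},x^*_i),\quad \beta_i=-h_{22}(x^*_{i-1},x^*_i)-h_{11}(x^*_i,x^*_{i+1}),$$ defines a bounded operator $A=-D^2W(\mathbf x^*)$ on the Hilbert space $\ell^2(\mathbb Z)$ (where $W(\mathbf x)=\sum_n [h(x_n,x_{n+1})-Fx_n]$ formally), and $0$ lies in the spectrum of $A$. -/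

import Mathlib

open Filter Topology

namespace FK

/-- A state of the chain. -/
abbrev State : Type := ℤ → ℝ

/-! ### Energy function and gradient vector field -/

/-- First partial derivative of `h` with respect to its first argument. -/
noncomputable def d1 (h : ℝ → ℝ → ℝ) (x x' : ℝ) : ℝ := deriv (fun y => h y x') x

/-- First partial derivative of `h` with respect to its second argument. -/
noncomputable def d2 (h : ℝ → ℝ → ℝ) (x x' : ℝ) : ℝ := deriv (fun y => h x y) x'

/-- Second partial derivatives. -/
noncomputable def d11 (h : ℝ → ℝ → ℝ) (x x' : ℝ) : ℝ := d1 (d1 h) x x'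

noncomputable def d12 (h : ℝ → ℝ → ℝ) (x x' : ℝ) : ℝ := d2 (d1 h) x x'

noncomputable def d22 (h : ℝ → ℝ → ℝ) (x x' : ℝ) : ℝ := d2 (d2 h) x x'

/-- Standing assumptions on the energy function: `C^2`, diagonally periodic, and
`h_12 ≤ -c < 0` for some constant `c`. -/
structure IsEnergy (h : ℝ → ℝ → ℝ) : Prop where
  contDiff : ContDiff ℝ 2 (fun z : ℝ × ℝ => h z.1 z.2)
  periodic : ∀ x x' : ℝ, h (x + 1) (x' + 1) = h x x'
  twist : ∃ c : ℝ, 0 < c ∧ ∀ x x' : ℝ, d12 h x x' ≤ -c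

/-- The gradient vector field of the chain with tilt `F`:
the `n`-th component is `-h_2(x_{n-1}, x_n) - h_1(x_n, x_{n+1}) + F`. -/
noncomputable def field (h : ℝ → ℝ → ℝ) (F : ℝ) (x : State) (n : ℤ) : ℝ :=
  -d2 h (x (n - 1)) (x n) - d1 h (x n) (x (n + 1)) + F

/-- Equilibria of the tilted chain. -/
def IsEquilibrium (h : ℝ → ℝ → ℝ) (F : ℝ) (x : State) : Prop :=
  ∀ n : ℤ, field h F x n = 0

/-- The translations `(T_{qp} x)_n = x_{n-q} + p`. -/
def T (q p : ℤ) (x : State) : State := fun n => x (n - q) + (p : ℝ)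

/-- `x` has mean spacing `ω`: `(x_n - x_0) / n → ω` as `n → ±∞`. -/
def HasMeanSpacing (x : State) (ω : ℝ) : Prop :=
  Tendsto (fun n : ℤ => (x n - x 0) / (n : ℝ)) atTop (𝓝 ω) ∧
    Tendsto (fun n : ℤ => (x n - x 0) / (n : ℝ)) atBot (𝓝 ω)

/-! ### Phase spaces -/

/-- The weight `2^{-|n|}`. -/
noncomputable def weight (n : ℤ) : ℝ := (2 : ℝ)⁻¹ ^ n.natAbs

/-- The space `𝒳` of states with `∑ 2^{-|n|} |x_n| < ∞`. -/
def X : Set State := {x | Summable fun n : ℤ => weight n * |x n|}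

/-- The norm of `𝒳`. -/
noncomputable def normX (x : State) : ℝ := ∑' n : ℤ, weight n * |x n|

/-- The states of width at most `k`: for every `m` the numbers
`n⁻(m) = max {n | T_{mn} x ≤ x}` and `n⁺(m) = min {n | T_{mn} x ≥ x}` exist and differ by at
most `k`. -/
def WidthLE (x : State) (k : ℤ) : Prop :=
  ∀ m : ℤ, ∃ nminus nplus : ℤ,
    IsGreatest {n : ℤ | T m n x ≤ x} nminus ∧ IsLeast {n : ℤ | x ≤ T m n x} nplus ∧
      nplus - nminus ≤ k

/-- `𝒳_ω^1`: the states in `𝒳` with `x_n - n ω` bounded and width at most one. -/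
def Xone (ω : ℝ) : Set State :=
  {x | x ∈ X ∧ (∃ B : ℝ, ∀ n : ℤ, |x n - (n : ℝ) * ω| ≤ B) ∧ WidthLE x 1}

/-! ### Average velocity and depinning force -/

/-- `x` is a forward orbit of the gradient flow in `𝒳_ω^1`. (On `𝒳_ω^1` all spacings
`x_{n+1} - x_n` lie in a fixed bounded interval, where the field is Lipschitz, so that the orbit
through a given initial state is unique.) -/
def IsForwardOrbit (h : ℝ → ℝ → ℝ) (F ω : ℝ) (x : ℝ → State) : Prop :=
  ∀ t : ℝ, 0 ≤ t → x t ∈ Xone ω ∧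
    ∀ n : ℤ, HasDerivWithinAt (fun s => x s n) (field h F (x t) n) (Set.Ici 0) t

/-- The orbit `x` has average velocity
`ν = lim (1 / (t (m - k))) ∫_0^t ∑_{n=k}^{m-1} ẋ_n(s) ds` as `m - k → ∞` and `t → ∞`.
The variable is `a = ((k, m), t)`. -/
def HasAverageVelocity (h : ℝ → ℝ → ℝ) (F : ℝ) (x : ℝ → State) (ν : ℝ) : Prop :=
  Tendsto
    (fun a : (ℤ × ℤ) × ℝ =>
      1 / (a.2 * ((a.1.2 : ℝ) - (a.1.1 : ℝ))) *
        ∫ s in (0 : ℝ)..a.2, ∑ n ∈ Finset.Ico a.1.1 a.1.2, field h F (x s) n)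
    (comap (fun a : (ℤ × ℤ) × ℝ => a.1.2 - a.1.1) atTop ⊓
      comap (fun a : (ℤ × ℤ) × ℝ => a.2) atTop)
    (𝓝 ν)

/-- `ν` is the average velocity for mean spacing `ω` and tilt `F`, i.e. the common
average velocity of the orbits in `𝒳_ω^1`. -/
def IsAverageVelocity (h : ℝ → ℝ → ℝ) (ω F ν : ℝ) : Prop :=
  ∀ x : ℝ → State, IsForwardOrbit h F ω x → HasAverageVelocity h F x ν

/-- The depinning force `F_d(ω) = sup {F ≥ 0 | average velocity at (ω, F) is 0}`. -/
noncomputable def depinningForce (h : ℝ → ℝ → ℝ) (ω : ℝ) : ℝ :=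
  sSup {F : ℝ | 0 ≤ F ∧ IsAverageVelocity h ω F 0}

/-- The value `F_d(ω₀+) = limsup_{ω ↘ ω₀} F_d(ω)`. -/
noncomputable def depinningForcePlus (h : ℝ → ℝ → ℝ) (ω₀ : ℝ) : ℝ :=
  limsup (fun ω : ℝ => depinningForce h ω) (𝓝[>] ω₀)

/-! ### Invariant ordered circles -/

/-- Ordered circles: images of maps `τ : ℝ → 𝒳`, continuous for the norm of `𝒳`, with
`τ s₁ < τ s₂` for `s₁ < s₂` and `τ (s + 1) = τ s + 𝟏`. -/
def IsOrderedCircle (ℓ : Set State) : Prop :=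
  ∃ τ : ℝ → State,
    (∀ s, τ s ∈ X) ∧
    (∀ s, Tendsto (fun r => normX (τ r - τ s)) (𝓝 s) (𝓝 0)) ∧
    (∀ s₁ s₂, s₁ < s₂ → τ s₁ < τ s₂) ∧
    (∀ s, τ (s + 1) = τ s + 1) ∧
    ℓ = Set.range τ

/-- Translation-invariant ordered circles. -/
def IsTOC (ℓ : Set State) : Prop :=
  IsOrderedCircle ℓ ∧ ∀ q p : ℤ, T q p '' ℓ = ℓ

/-- Invariance under the gradient flow for all `t ∈ ℝ`: through each state of `ℓ` there is an
orbit, defined for all times, that stays in `ℓ`. (The spacings of the states of a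
translation-invariant ordered circle lie in a fixed bounded interval, so such an orbit is the
orbit of the flow.) -/
def IsFlowInvariant (h : ℝ → ℝ → ℝ) (F : ℝ) (ℓ : Set State) : Prop :=
  ∀ x ∈ ℓ, ∃ u : ℝ → State, u 0 = x ∧
    (∀ (t : ℝ) (n : ℤ), HasDerivAt (fun s => u s n) (field h F (u t) n) t) ∧
    ∀ t : ℝ, u t ∈ ℓ

/-- Invariant ordered circles for tilt `F`. -/
def IsIOC (h : ℝ → ℝ → ℝ) (F : ℝ) (ℓ : Set State) : Prop :=
  IsTOC ℓ ∧ IsFlowInvariant h F ℓ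

/-- Invariant ordered circles of type `p/q+`. -/
def IsIOCPlus (h : ℝ → ℝ → ℝ) (F : ℝ) (p : ℤ) (q : ℕ) (ℓ : Set State) : Prop :=
  IsIOC h F ℓ ∧
    (∀ x ∈ ℓ, HasMeanSpacing x ((p : ℝ) / (q : ℝ)) ∧ T q p x ≤ x) ∧
    ∃ x ∈ ℓ, T q p x ≠ x

/-- Equilibria of type `p/q+`: mean spacing `p/q` and `T_{qp} x < x`, i.e. `T_{qp} x ≤ x` and
`T_{qp} x ≠ x`. -/
def IsEquilibriumPlus (h : ℝ → ℝ → ℝ) (F : ℝ) (p : ℤ) (q : ℕ) (x : State) : Prop :=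
  IsEquilibrium h F x ∧ HasMeanSpacing x ((p : ℝ) / (q : ℝ)) ∧ T q p x < x

/-! ### Degeneracy -/

/-- The real Hilbert space `ℓ²` of square-summable two-sided sequences. -/
abbrev Ell2 : Type := lp (fun _ : ℤ => ℝ) 2

/-- `A` is the Jacobi operator `-D²W(x)` on `ℓ²`:
`(A η)_i = α_i η_{i-1} + β_i η_i + α_{i+1} η_{i+1}` with `α_i = -h_12(x_{i-1}, x_i)` and
`β_i = -h_22(x_{i-1}, x_i) - h_11(x_i, x_{i+1})`. -/
def IsJacobiOperator (h : ℝ → ℝ → ℝ) (x : State) (A : Ell2 →L[ℝ] Ell2) : Prop :=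
  ∀ (η : Ell2) (i : ℤ),
    (A η) i = -d12 h (x (i - 1)) (x i) * η (i - 1)
      + (-d22 h (x (i - 1)) (x i) - d11 h (x i) (x (i + 1))) * η i
      + -d12 h (x i) (x (i + 1)) * η (i + 1)

/-- `x` is degenerate: `-D²W(x)` is a bounded operator on `ℓ²` and has `0` in its
spectrum. The formula determines the operator, so there is at most one such `A`. -/
def IsDegenerate (h : ℝ → ℝ → ℝ) (x : State) : Prop :=
  ∃ A : Ell2 →L[ℝ] Ell2, IsJacobiOperator h x A ∧ (0 : ℝ) ∈ spectrum ℝ A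

end FK

/-!
A state `z < x` of `ℓ` has nonnegative velocity, so `x - z` is, to first order, a supersolution of
the linearization `A` at the equilibrium `x`; it is positive at every site because `h₁₂ < 0`. By the
criterion of Allegretto and Piepenbrink, applied on larger and larger finite sets of sites, `A ≤ 0`.

The translate `y = T_{-q,-p} x > x` differs from `x` by an `ℓ¹` sequence, since `x_n - n p / q` is
bounded and increases under `n ↦ n + q`. For a state `z` of `ℓ` with `x < z ≤ y`, the difference
`w = z - x ≥ 0` is then in `ℓ²`, and it is a subsolution to first order. Letting `z` decrease to `x`
shows that the form `⟪w, A w⟫` is not bounded above by a negative multiple of `‖w‖²`. Since `A` is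
symmetric, `0` lies in its spectrum.
-/

namespace FK

open scoped ENNReal RealInnerProductSpace lp

section Spectrum

variable {𝕜 H : Type*} [RCLike 𝕜] [NormedAddCommGroup H] [InnerProductSpace 𝕜 H]
  {P : H →L[𝕜] H}

theorem norm_apply_sq_le_of_isPositive (hP : P.IsPositive) (v : H) :
    ‖P v‖ ^ 2 ≤ ‖P‖ * RCLike.re (inner 𝕜 (P v) v) := by
  rcases eq_or_ne P 0 with rfl | hP0
  · simp
  have hM : 0 < ‖P‖ := norm_pos_iff.2 hP0
  have hsecond : RCLike.re (inner 𝕜 (P (P v)) (P v)) ≤ ‖P‖ * ‖P v‖ ^ 2 :=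
    calc RCLike.re (inner 𝕜 (P (P v)) (P v)) ≤ ‖P (P v)‖ * ‖P v‖ := re_inner_le_norm _ _
      _ ≤ ‖P‖ * ‖P v‖ * ‖P v‖ := by gcongr; exact P.le_opNorm _
      _ = ‖P‖ * ‖P v‖ ^ 2 := by ring
  have hform : 0 ≤ ‖P‖ ^ 2 * RCLike.re (inner 𝕜 (P v) v) - 2 * ‖P‖ * ‖P v‖ ^ 2 +
      RCLike.re (inner 𝕜 (P (P v)) (P v)) := by
    refine (hP.re_inner_nonneg_left ((‖P‖ : 𝕜) • v - P v)).trans_eq ?_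
    simp only [map_sub, map_smul, inner_sub_left, inner_sub_right, inner_smul_left,
      inner_smul_right, RCLike.conj_ofReal, RCLike.re_ofReal_mul,
      hP.inner_left_eq_inner_right (P v) v, inner_self_eq_norm_sq]
    ring
  refine le_of_mul_le_mul_left ?_ hM
  linarith

theorem zero_mem_spectrum_of_isPositive (hP : P.IsPositive)
    (hbottom : ∀ ε > 0, ∃ v ≠ 0, RCLike.re (inner 𝕜 (P v) v) ≤ ε * ‖v‖ ^ 2) :
    (0 : 𝕜) ∈ spectrum 𝕜 P := by
  rw [spectrum.zero_mem_iff]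
  rintro ⟨U, rfl⟩
  set e := ContinuousLinearEquiv.unitsEquiv 𝕜 H U
  obtain ⟨b, hb, hlower⟩ : ∃ b > 0, ∀ v, ‖v‖ ≤ b * ‖U.val v‖ :=
    ⟨‖(e.symm : H →L[𝕜] H)‖ + 1, by positivity, fun v =>
      calc ‖v‖ = ‖e.symm (e v)‖ := by rw [e.symm_apply_apply]
        _ ≤ ‖(e.symm : H →L[𝕜] H)‖ * ‖e v‖ := (e.symm : H →L[𝕜] H).le_opNorm _
        _ ≤ (‖(e.symm : H →L[𝕜] H)‖ + 1) * ‖U.val v‖ := by gcongr; exacts [by simp, le_rfl]⟩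
  set c := b ^ 2 * (‖U.val‖ + 1)
  obtain ⟨v, hv, hsmall⟩ := hbottom (2 * c)⁻¹ (by positivity)
  have hpos : 0 < ‖v‖ ^ 2 := by positivity
  have hhalf : ‖v‖ ^ 2 ≤ ‖v‖ ^ 2 / 2 :=
    calc ‖v‖ ^ 2 ≤ (b * ‖U.val v‖) ^ 2 := by gcongr; exact hlower v
      _ = b ^ 2 * ‖U.val v‖ ^ 2 := mul_pow _ _ _
      _ ≤ b ^ 2 * (‖U.val‖ * RCLike.re (inner 𝕜 (U.val v) v)) := by
        gcongr; exact norm_apply_sq_le_of_isPositive hP v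
      _ ≤ b ^ 2 * ((‖U.val‖ + 1) * ((2 * c)⁻¹ * ‖v‖ ^ 2)) := by
        gcongr
        · exact hP.re_inner_nonneg_left v
        · linarith
      _ = ‖v‖ ^ 2 / 2 := by simp only [c]; field_simp
  linarith

end Spectrum

section Sequences

variable {ι : Type*}

/-- Multiplication by a bounded sequence, as a bounded operator on `ℓ^p`. -/
noncomputable def mulOp {p : ℝ≥0∞} [Fact (1 ≤ p)] (a : ℓ^∞(ι, ℝ)) :
    lp (fun _ : ι => ℝ) p →L[ℝ] lp (fun _ : ι => ℝ) p :=
  have hle (η : lp (fun _ : ι => ℝ) p) (i : ι) : ‖a i * η i‖ ≤ ‖(‖a‖ • η) i‖ := by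
    rw [lp.coeFn_smul, Pi.smul_apply, norm_mul, norm_smul, norm_norm]
    gcongr
    exact lp.norm_apply_le_norm ENNReal.top_ne_zero a i
  LinearMap.mkContinuous
    { toFun := fun η => ⟨fun i => a i * η i, (lp.memℓp (‖a‖ • η)).mono' (hle η)⟩
      map_add' := fun _ _ => lp.ext (funext fun _ => mul_add _ _ _)
      map_smul' := fun _ _ => lp.ext (funext fun _ => mul_left_comm _ _ _) }
    ‖a‖ fun η => by
      have hp : p ≠ 0 := (zero_lt_one.trans_le Fact.out).ne'
      simpa only [lp.norm_const_smul hp, norm_norm] using lp.norm_mono (y := ‖a‖ • η) hp (hle η)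

@[simp]
theorem mulOp_apply {p : ℝ≥0∞} [Fact (1 ≤ p)] (a : ℓ^∞(ι, ℝ)) (η : lp (fun _ : ι => ℝ) p)
    (i : ι) : mulOp a η i = a i * η i :=
  rfl

theorem norm_mulOp_le {p : ℝ≥0∞} [Fact (1 ≤ p)] (a : ℓ^∞(ι, ℝ)) :
    ‖(mulOp a : lp (fun _ : ι => ℝ) p →L[ℝ] lp (fun _ : ι => ℝ) p)‖ ≤ ‖a‖ := by
  unfold mulOp
  exact LinearMap.mkContinuous_norm_le _ (norm_nonneg a) _

theorem inner_mulOp_left (a : ℓ^∞(ι, ℝ)) (u v : ℓ²(ι, ℝ)) : ⟪mulOp a u, v⟫ = ⟪u, mulOp a v⟫ := by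
  simp only [lp.inner_eq_tsum, mulOp_apply, RCLike.inner_apply, conj_trivial, mul_assoc,
    mul_left_comm]

/-- Reindexing of square-summable families by a permutation of the index set. -/
noncomputable def reindex (σ : Equiv.Perm ι) : ℓ²(ι, ℝ) ≃ₗᵢ[ℝ] ℓ²(ι, ℝ) where
  toFun η := ⟨fun i => η (σ i), memℓp_gen <|
    σ.summable_iff.2 ((lp.memℓp η).summable (by norm_num))⟩
  invFun η := ⟨fun i => η (σ.symm i), memℓp_gen <|
    σ.symm.summable_iff.2 ((lp.memℓp η).summable (by norm_num))⟩
  left_inv η := lp.ext (funext fun i => congrArg η (σ.apply_symm_apply i))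
  right_inv η := lp.ext (funext fun i => congrArg η (σ.symm_apply_apply i))
  map_add' _ _ := rfl
  map_smul' _ _ := rfl
  norm_map' η := by
    simp only [lp.norm_eq_tsum_rpow (p := 2) (by norm_num)]
    congr 1
    exact σ.tsum_eq fun i => ‖η i‖ ^ (2 : ℝ≥0∞).toReal

theorem dense_setOf_finite_support {E : ι → Type*} [∀ i, NormedAddCommGroup (E i)] {p : ℝ≥0∞}
    [Fact (1 ≤ p)] (hp : p ≠ ⊤) : Dense {v : lp E p | {i | v i ≠ 0}.Finite} := by
  classical
  intro v
  refine mem_closure_of_tendsto (lp.hasSum_single hp v) (.of_forall fun s => ?_)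
  refine s.finite_toSet.subset fun i hi => ?_
  contrapose! hi
  simp only [lp.coeFn_sum, Set.mem_ofPred_eq, not_not, Finset.sum_apply, lp.coeFn_single]
  exact Finset.sum_eq_zero fun j hj => Pi.single_eq_of_ne (ne_of_mem_of_not_mem hj hi).symm _

end Sequences

section Jacobi

/-- The Jacobi (symmetric tridiagonal) difference expression with off-diagonal entries `α` and
diagonal entries `β`; the entry coupling the sites `i - 1` and `i` is `α i`. -/
def jacobi (α β u : ℤ → ℝ) (i : ℤ) : ℝ :=
  α i * u (i - 1) + β i * u i + α (i + 1) * u (i + 1)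

/-- The operator on `ℓ²` given by the Jacobi difference expression with bounded entries. -/
noncomputable def jacobiOp (α β : ℓ^∞(ℤ, ℝ)) : Ell2 →L[ℝ] Ell2 :=
  mulOp α ∘L (reindex (Equiv.subRight (1 : ℤ))).toContinuousLinearEquiv + mulOp β +
    (reindex (Equiv.addRight (1 : ℤ))).toContinuousLinearEquiv ∘L mulOp α

variable {α β u v : ℤ → ℝ}

theorem jacobiOp_apply (α β : ℓ^∞(ℤ, ℝ)) (u : Ell2) (i : ℤ) :
    jacobiOp α β u i = jacobi α β u i :=
  rfl

theorem inner_jacobiOp_left (α β : ℓ^∞(ℤ, ℝ)) (u v : Ell2) :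
    ⟪jacobiOp α β u, v⟫ = ⟪u, jacobiOp α β v⟫ := by
  let R : Ell2 ≃ₗᵢ[ℝ] Ell2 := reindex (Equiv.addRight 1)
  have hop (w : Ell2) :
      jacobiOp α β w = mulOp α (R.symm w) + mulOp β w + R (mulOp α w) := rfl
  simp only [hop, inner_add_left, inner_add_right, inner_mulOp_left,
    LinearIsometryEquiv.inner_map_eq_flip, LinearIsometryEquiv.symm_symm]
  ring

theorem norm_jacobiOp_le (α β : ℓ^∞(ℤ, ℝ)) : ‖jacobiOp α β‖ ≤ 2 * ‖α‖ + ‖β‖ := by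
  refine ContinuousLinearMap.opNorm_le_bound _ (by positivity) fun u => ?_
  calc ‖jacobiOp α β u‖
      ≤ ‖mulOp α (reindex (Equiv.subRight 1) u)‖ + ‖mulOp β u‖ +
          ‖reindex (Equiv.addRight 1) (mulOp α u)‖ := norm_add₃_le
    _ ≤ ‖α‖ * ‖u‖ + ‖β‖ * ‖u‖ + ‖α‖ * ‖u‖ := by
      rw [LinearIsometryEquiv.norm_map]
      gcongr
      · simpa using (mulOp α).le_of_opNorm_le (norm_mulOp_le α) (reindex (Equiv.subRight 1) u)
      · exact (mulOp β).le_of_opNorm_le (norm_mulOp_le β) u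
      · exact (mulOp α).le_of_opNorm_le (norm_mulOp_le α) u
    _ = (2 * ‖α‖ + ‖β‖) * ‖u‖ := by ring

theorem inner_jacobiOp (α β : ℓ^∞(ℤ, ℝ)) (u v : Ell2) :
    ⟪u, jacobiOp α β v⟫ = ∑' i, u i * jacobi α β v i := by
  simp [lp.inner_eq_tsum, jacobiOp_apply, mul_comm]

/-- Picone's identity: the difference of the two sides is
`α_{i+1} (u_{i+1} v_i - u_i v_{i+1})² / (u_i u_{i+1}) - v_i² / u_i (Ju)_i`. -/
theorem mul_jacobi_le_sub (hα : ∀ i, 0 ≤ α i) (hu : ∀ i, 0 < u i) {i : ℤ}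
    (hi : v i ≠ 0 → jacobi α β u i ≤ 0) :
    v i * jacobi α β v i ≤
      α i * (v (i - 1) * v i - u (i - 1) / u i * v i ^ 2) -
        α (i + 1) * (v i * v (i + 1) - u i / u (i + 1) * v (i + 1) ^ 2) := by
  have h₀ := hu i
  have h₁ := hu (i + 1)
  have hsq : 0 ≤ α (i + 1) * (u (i + 1) * v i - u i * v (i + 1)) ^ 2 / (u i * u (i + 1)) := by
    have := hα (i + 1)
    positivity
  have hsuper : v i ^ 2 / u i * jacobi α β u i ≤ 0 := by
    rcases eq_or_ne (v i) 0 with hv | hv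
    · simp [hv]
    · exact mul_nonpos_of_nonneg_of_nonpos (by positivity) (hi hv)
  rw [← sub_nonneg]
  refine (sub_nonneg.2 (hsuper.trans hsq)).trans_eq ?_
  unfold jacobi
  field_simp
  ring

theorem tsum_mul_jacobi_nonpos_of_supersolution (hα : ∀ i, 0 ≤ α i) (hu : ∀ i, 0 < u i)
    (hv : (Function.support v).Finite) (hsuper : ∀ i, v i ≠ 0 → jacobi α β u i ≤ 0) :
    ∑' i, v i * jacobi α β v i ≤ 0 := by
  set P : ℤ → ℝ := fun i => α i * (v (i - 1) * v i - u (i - 1) / u i * v i ^ 2) with hP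
  have hPsum : Summable P := summable_of_hasFiniteSupport <| hv.subset fun i hi => by
    contrapose! hi
    simp_all
  have hPsucc : Summable fun i => P (i + 1) := (Equiv.addRight (1 : ℤ)).summable_iff.2 hPsum
  calc ∑' i, v i * jacobi α β v i
      ≤ ∑' i, (P i - P (i + 1)) := by
        refine Summable.tsum_le_tsum (fun i => ?_) ?_ (hPsum.sub hPsucc)
        · simpa [hP] using mul_jacobi_le_sub hα hu (hsuper i)
        · exact summable_of_hasFiniteSupport (hv.subset (Function.support_mul_subset_left _ _))
    _ = 0 := by
      rw [hPsum.tsum_sub hPsucc]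
      exact sub_eq_zero.2 ((Equiv.addRight (1 : ℤ)).tsum_eq P).symm

theorem jacobi_sub_smul_one (δ : ℝ) (u : ℤ → ℝ) (i : ℤ) :
    jacobi (α - δ • 1) (β - δ • 1) u i = jacobi α β u i - δ * jacobi 1 1 u i := by
  simp only [jacobi, Pi.sub_apply, Pi.smul_apply, Pi.one_apply, smul_eq_mul]
  ring

theorem jacobiOp_sub_smul_one (α β : ℓ^∞(ℤ, ℝ)) (δ : ℝ) :
    jacobiOp (α - δ • 1) (β - δ • 1) = jacobiOp α β - δ • jacobiOp 1 1 := by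
  ext u i
  exact jacobi_sub_smul_one δ u i

theorem inner_jacobiOp_one_le (v : Ell2) : ⟪v, jacobiOp 1 1 v⟫ ≤ 3 * ‖v‖ ^ 2 := by
  have hnorm : ‖jacobiOp 1 1‖ ≤ 3 := (norm_jacobiOp_le 1 1).trans_eq (by rw [norm_one]; norm_num)
  calc ⟪v, jacobiOp 1 1 v⟫ ≤ ‖v‖ * ‖jacobiOp 1 1 v‖ := real_inner_le_norm _ _
    _ ≤ ‖v‖ * (3 * ‖v‖) := by
      gcongr
      exact (jacobiOp 1 1).le_of_opNorm_le hnorm v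
    _ = 3 * ‖v‖ ^ 2 := by ring

theorem inner_jacobiOp_le_of_supersolution {α β : ℓ^∞(ℤ, ℝ)} {δ : ℝ} (hδ : 0 ≤ δ)
    (hα : ∀ i, δ ≤ α i) (hu : ∀ i, 0 < u i) {v : Ell2} (hv : (Function.support v).Finite)
    (hsuper : ∀ i, v i ≠ 0 → jacobi α β u i ≤ δ * jacobi 1 1 u i) :
    ⟪v, jacobiOp α β v⟫ ≤ 3 * δ * ‖v‖ ^ 2 := by
  have hform : ⟪v, jacobiOp (α - δ • 1) (β - δ • 1) v⟫ ≤ 0 := by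
    rw [inner_jacobiOp]
    refine tsum_mul_jacobi_nonpos_of_supersolution (fun i => ?_) hu hv fun i hi => ?_
    · exact sub_nonneg.2 ((mul_one δ).trans_le (hα i))
    · exact (jacobi_sub_smul_one δ u i).trans_le (sub_nonpos.2 (hsuper i hi))
  rw [jacobiOp_sub_smul_one, sub_apply, smul_apply, inner_sub_right, inner_smul_right] at hform
  linarith [mul_le_mul_of_nonneg_left (inner_jacobiOp_one_le v) hδ]

theorem neg_le_inner_jacobiOp_of_subsolution {α β : ℓ^∞(ℤ, ℝ)} {δ : ℝ} (hδ : 0 ≤ δ)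
    {w : Ell2} (hw : ∀ i, 0 ≤ w i) (hsub : ∀ i, -(δ * jacobi 1 1 w i) ≤ jacobi α β w i) :
    -(3 * δ * ‖w‖ ^ 2) ≤ ⟪w, jacobiOp α β w⟫ := by
  have hform : 0 ≤ ⟪w, jacobiOp (α - (-δ) • 1) (β - (-δ) • 1) w⟫ := by
    rw [inner_jacobiOp]
    refine tsum_nonneg fun i => mul_nonneg (hw i) ?_
    refine (sub_nonneg.2 ?_).trans_eq (jacobi_sub_smul_one (-δ) w i).symm
    exact (neg_mul δ _).trans_le (hsub i)
  rw [jacobiOp_sub_smul_one, sub_apply, smul_apply, inner_sub_right, inner_smul_right] at hform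
  linarith [mul_le_mul_of_nonneg_left (inner_jacobiOp_one_le w) hδ]

end Jacobi

section BottomOfSpectrum

variable {α β : ℓ^∞(ℤ, ℝ)}

theorem inner_jacobiOp_nonpos {c : ℝ} (hc : 0 < c) (hα : ∀ i, c ≤ α i)
    (hsuper : ∀ S : Set ℤ, S.Finite → ∀ δ > 0, ∃ u : ℤ → ℝ, (∀ i, 0 < u i) ∧
      ∀ i ∈ S, jacobi α β u i ≤ δ * jacobi 1 1 u i) (v : Ell2) :
    ⟪v, jacobiOp α β v⟫ ≤ 0 := by
  refine (dense_setOf_finite_support (E := fun _ : ℤ => ℝ) (p := 2) ENNReal.ofNat_ne_top).induction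
    (P := fun v : Ell2 => ⟪v, jacobiOp α β v⟫ ≤ 0) (fun v hv => ?_)
    (isClosed_le (by fun_prop) continuous_const) v
  have hlim : Tendsto (fun δ : ℝ => 3 * δ * ‖v‖ ^ 2) (𝓝[>] 0) (𝓝 0) := by
    refine (Continuous.tendsto' (by fun_prop) _ _ ?_).mono_left nhdsWithin_le_nhds
    simp
  refine ge_of_tendsto hlim ?_
  filter_upwards [Ioo_mem_nhdsGT hc] with δ ⟨hδ, hδc⟩
  obtain ⟨u, hu, hsuper⟩ := hsuper _ hv δ hδ
  exact inner_jacobiOp_le_of_supersolution hδ.le (fun i => hδc.le.trans (hα i)) hu hv hsuper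

theorem zero_mem_spectrum_jacobiOp {c : ℝ} (hc : 0 < c) (hα : ∀ i, c ≤ α i)
    (hsuper : ∀ S : Set ℤ, S.Finite → ∀ δ > 0, ∃ u : ℤ → ℝ, (∀ i, 0 < u i) ∧
      ∀ i ∈ S, jacobi α β u i ≤ δ * jacobi 1 1 u i)
    (hsub : ∀ δ > 0, ∃ w : Ell2, w ≠ 0 ∧ (∀ i, 0 ≤ w i) ∧
      ∀ i, -(δ * jacobi 1 1 w i) ≤ jacobi α β w i) :
    0 ∈ spectrum ℝ (jacobiOp α β) := by
  have hpos : (-jacobiOp α β).IsPositive := by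
    refine (ContinuousLinearMap.isPositive_iff _).2 ⟨fun u v => ?_, fun v => ?_⟩
    · simpa using inner_jacobiOp_left α β u v
    · simpa [inner_jacobiOp_left] using inner_jacobiOp_nonpos hc hα hsuper v
  suffices (0 : ℝ) ∈ spectrum ℝ (-jacobiOp α β) by
    simpa [spectrum.zero_mem_iff] using this
  refine zero_mem_spectrum_of_isPositive hpos fun ε hε => ?_
  obtain ⟨w, hw₀, hw, hsub⟩ := hsub (ε / 3) (by positivity)
  refine ⟨w, hw₀, ?_⟩
  have := neg_le_inner_jacobiOp_of_subsolution (by positivity) hw hsub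
  rw [neg_apply, inner_neg_left, inner_jacobiOp_left, RCLike.re_to_real]
  linarith

end BottomOfSpectrum

section Calculus

variable {g : ℝ → ℝ → ℝ}

theorem fderiv_apply_eq_d1_add_d2 {n : WithTop ℕ∞}
    (hg : ContDiff ℝ n (fun z : ℝ × ℝ => g z.1 z.2)) (hn : n ≠ 0) (z v : ℝ × ℝ) :
    fderiv ℝ (fun z : ℝ × ℝ => g z.1 z.2) z v = d1 g z.1 z.2 * v.1 + d2 g z.1 z.2 * v.2 := by
  have hd := (hg.differentiable hn z).hasFDerivAt
  have h1 : HasDerivAt (fun t => g t z.2) (fderiv ℝ (fun z : ℝ × ℝ => g z.1 z.2) z (1, 0)) z.1 :=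
    hd.comp_hasDerivAt (f := fun t => (t, z.2)) z.1
      ((hasDerivAt_id z.1).prodMk (hasDerivAt_const z.1 z.2))
  have h2 : HasDerivAt (fun t => g z.1 t) (fderiv ℝ (fun z : ℝ × ℝ => g z.1 z.2) z (0, 1)) z.2 :=
    hd.comp_hasDerivAt (f := fun t => (z.1, t)) z.2
      ((hasDerivAt_const z.2 z.1).prodMk (hasDerivAt_id z.2))
  have hv : v = v.1 • ((1 : ℝ), (0 : ℝ)) + v.2 • ((0 : ℝ), (1 : ℝ)) := by ext <;> simp
  conv_lhs => rw [hv]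
  rw [map_add, map_smul, map_smul, smul_eq_mul, smul_eq_mul, ← h1.deriv, ← h2.deriv, d1, d2,
    mul_comm, mul_comm v.2]

theorem d1_eq_fderiv {n : WithTop ℕ∞} (hg : ContDiff ℝ n (fun z : ℝ × ℝ => g z.1 z.2))
    (hn : n ≠ 0) (x y : ℝ) :
    d1 g x y = fderiv ℝ (fun z : ℝ × ℝ => g z.1 z.2) (x, y) (1, 0) := by
  simp [fderiv_apply_eq_d1_add_d2 hg hn]

theorem d2_eq_fderiv {n : WithTop ℕ∞} (hg : ContDiff ℝ n (fun z : ℝ × ℝ => g z.1 z.2))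
    (hn : n ≠ 0) (x y : ℝ) :
    d2 g x y = fderiv ℝ (fun z : ℝ × ℝ => g z.1 z.2) (x, y) (0, 1) := by
  simp [fderiv_apply_eq_d1_add_d2 hg hn]

theorem contDiff_d1 {m n : WithTop ℕ∞} (hg : ContDiff ℝ n (fun z : ℝ × ℝ => g z.1 z.2))
    (hmn : m + 1 ≤ n) : ContDiff ℝ m (fun z : ℝ × ℝ => d1 g z.1 z.2) := by
  have hn : n ≠ 0 := by rintro rfl; simp at hmn
  simp only [d1_eq_fderiv hg hn]
  exact (hg.fderiv_right hmn).clm_apply contDiff_const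

theorem contDiff_d2 {m n : WithTop ℕ∞} (hg : ContDiff ℝ n (fun z : ℝ × ℝ => g z.1 z.2))
    (hmn : m + 1 ≤ n) : ContDiff ℝ m (fun z : ℝ × ℝ => d2 g z.1 z.2) := by
  have hn : n ≠ 0 := by rintro rfl; simp at hmn
  simp only [d2_eq_fderiv hg hn]
  exact (hg.fderiv_right hmn).clm_apply contDiff_const

theorem d1_d2_eq_d12 (hg : ContDiff ℝ 2 (fun z : ℝ × ℝ => g z.1 z.2)) (x y : ℝ) :
    d1 (d2 g) x y = d12 g x y := by
  have h1 : ContDiff ℝ 1 (fun z : ℝ × ℝ => d1 g z.1 z.2) := contDiff_d1 hg (by norm_num)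
  have h2 : ContDiff ℝ 1 (fun z : ℝ × ℝ => d2 g z.1 z.2) := contDiff_d2 hg (by norm_num)
  have hsymm : IsSymmSndFDerivAt ℝ (fun z : ℝ × ℝ => g z.1 z.2) (x, y) :=
    hg.contDiffAt.isSymmSndFDerivAt (by simp)
  have hd : DifferentiableAt ℝ (fderiv ℝ (fun z : ℝ × ℝ => g z.1 z.2)) (x, y) :=
    (hg.fderiv_right (m := 1) (by norm_num)).differentiable one_ne_zero _
  have hsnd (v w : ℝ × ℝ) :
      fderiv ℝ (fun z : ℝ × ℝ => fderiv ℝ (fun z : ℝ × ℝ => g z.1 z.2) (z.1, z.2) v) (x, y) w =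
        fderiv ℝ (fderiv ℝ (fun z : ℝ × ℝ => g z.1 z.2)) (x, y) w v := by
    rw [(hd.hasFDerivAt.clm_apply (hasFDerivAt_const v (x, y))).fderiv]
    simp
  rw [d12, d1_eq_fderiv h2 one_ne_zero, d2_eq_fderiv h1 one_ne_zero]
  simp only [d1_eq_fderiv hg two_ne_zero, d2_eq_fderiv hg two_ne_zero, hsnd]
  exact hsymm (1, 0) (0, 1)

theorem d1_add_one (hg : ∀ x x' : ℝ, g (x + 1) (x' + 1) = g x x') (x x' : ℝ) :
    d1 g (x + 1) (x' + 1) = d1 g x x' := by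
  unfold d1
  rw [← deriv_comp_add_const (f := fun y => g y (x' + 1))]
  simp only [hg]

theorem d2_add_one (hg : ∀ x x' : ℝ, g (x + 1) (x' + 1) = g x x') (x x' : ℝ) :
    d2 g (x + 1) (x' + 1) = d2 g x x' := by
  unfold d2
  rw [← deriv_comp_add_const (f := fun y => g (x + 1) y)]
  simp only [hg]

end Calculus

section Strip

variable {E : Type*} [NormedAddCommGroup E] {φ : ℝ × ℝ → E} {K : ℝ}

theorem sub_floor_zsmul_mem_prod_Icc {z : ℝ × ℝ} (hz : |z.2 - z.1| ≤ K) :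
    z - ⌊z.1⌋ • ((1 : ℝ), (1 : ℝ)) ∈ Set.Icc 0 1 ×ˢ Set.Icc (-K) (K + 1) := by
  have hle := Int.floor_le z.1
  have hlt := Int.lt_floor_add_one z.1
  obtain ⟨hl, hr⟩ := abs_le.1 hz
  simp only [Set.mem_prod, Set.mem_Icc, Prod.fst_sub, Prod.snd_sub, Prod.smul_fst, Prod.smul_snd,
    zsmul_one]
  refine ⟨⟨?_, ?_⟩, ⟨?_, ?_⟩⟩ <;> linarith

theorem memℓp_infty_comp_of_periodic {ι : Type*} (hφ : Continuous φ)
    (hper : Function.Periodic φ (1, 1)) {z : ι → ℝ × ℝ} (hz : ∀ i, |(z i).2 - (z i).1| ≤ K) :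
    Memℓp (fun i => φ (z i)) ∞ := by
  obtain ⟨C, hC⟩ := (isCompact_Icc.prod isCompact_Icc : IsCompact
    (Set.Icc (0 : ℝ) 1 ×ˢ Set.Icc (-K) (K + 1))).exists_bound_of_continuousOn hφ.continuousOn
  refine memℓp_infty ⟨C, ?_⟩
  rintro _ ⟨i, rfl⟩
  simpa only [hper.sub_zsmul_eq] using hC _ (sub_floor_zsmul_mem_prod_Icc (hz i))

theorem exists_norm_sub_le_of_periodic (hφ : Continuous φ) (hper : Function.Periodic φ (1, 1))
    (K : ℝ) {δ : ℝ} (hδ : 0 < δ) :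
    ∃ r > 0, ∀ z w : ℝ × ℝ, |z.2 - z.1| ≤ K → ‖w - z‖ ≤ r → ‖φ w - φ z‖ ≤ δ := by
  have huc := (isCompact_Icc.prod isCompact_Icc : IsCompact
    (Set.Icc (0 : ℝ) 1 ×ˢ Set.Icc (-K) (K + 1))).uniformContinuousAt_of_continuousAt
    φ (fun _ _ => hφ.continuousAt) (Metric.dist_mem_uniformity hδ)
  obtain ⟨r, hr, hclose⟩ := Metric.mem_uniformity_dist.1 huc
  refine ⟨r / 2, half_pos hr, fun z w hz hzw => ?_⟩
  have hdist : dist (z - ⌊z.1⌋ • ((1 : ℝ), (1 : ℝ))) (w - ⌊z.1⌋ • ((1 : ℝ), (1 : ℝ))) < r := by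
    rw [dist_sub_right, dist_comm, dist_eq_norm]
    exact hzw.trans_lt (half_lt_self hr)
  have := hclose hdist (sub_floor_zsmul_mem_prod_Icc hz)
  simp only [Set.mem_ofPred_eq, hper.sub_zsmul_eq] at this
  rw [← dist_eq_norm, dist_comm]
  exact this.le

theorem exists_linearization_le_of_periodic [NormedSpace ℝ E] (hφ : ContDiff ℝ 1 φ)
    (hper : Function.Periodic φ (1, 1)) (K : ℝ) {δ : ℝ} (hδ : 0 < δ) :
    ∃ r > 0, ∀ z w : ℝ × ℝ, |z.2 - z.1| ≤ K → ‖w - z‖ ≤ r →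
      ‖φ w - φ z - fderiv ℝ φ z (w - z)‖ ≤ δ * ‖w - z‖ := by
  have hper' : Function.Periodic (fderiv ℝ φ) (1, 1) := fun z => by
    rw [← fderiv_comp_add_right, hper.funext]
  obtain ⟨r, hr, hclose⟩ :=
    exists_norm_sub_le_of_periodic (hφ.continuous_fderiv one_ne_zero) hper' K hδ
  refine ⟨r, hr, fun z w hz hw => ?_⟩
  refine (convex_closedBall z r).norm_image_sub_le_of_norm_fderiv_le'
    (fun y _ => hφ.differentiable one_ne_zero y)
    (fun y hy => hclose z y hz ?_) (Metric.mem_closedBall_self hr.le) ?_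
  · rwa [← dist_eq_norm]
  · rwa [Metric.mem_closedBall, dist_eq_norm]

end Strip

section Linearization

/-- The off-diagonal coefficients `α_i = -h_12(x_{i-1}, x_i)` of the linearization of the gradient
field at `x`. -/
noncomputable def offDiag (h : ℝ → ℝ → ℝ) (x : State) (i : ℤ) : ℝ :=
  -d12 h (x (i - 1)) (x i)

/-- The diagonal coefficients `β_i = -h_22(x_{i-1}, x_i) - h_11(x_i, x_{i+1})` of the
linearization of the gradient field at `x`. -/
noncomputable def onDiag (h : ℝ → ℝ → ℝ) (x : State) (i : ℤ) : ℝ :=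
  -d22 h (x (i - 1)) (x i) - d11 h (x i) (x (i + 1))

namespace IsEnergy

variable {h : ℝ → ℝ → ℝ} {F K : ℝ} {x z : State}

theorem contDiff_d1 (hh : IsEnergy h) : ContDiff ℝ 1 (fun z : ℝ × ℝ => d1 h z.1 z.2) :=
  FK.contDiff_d1 hh.contDiff (by norm_num)

theorem contDiff_d2 (hh : IsEnergy h) : ContDiff ℝ 1 (fun z : ℝ × ℝ => d2 h z.1 z.2) :=
  FK.contDiff_d2 hh.contDiff (by norm_num)

theorem memℓp_offDiag (hh : IsEnergy h) (hK : ∀ n, |x (n + 1) - x n| ≤ K) :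
    Memℓp (offDiag h x) ∞ := by
  have hcont : Continuous (fun z : ℝ × ℝ => d12 h z.1 z.2) :=
    (FK.contDiff_d2 (m := 0) hh.contDiff_d1 (by norm_num)).continuous
  exact (memℓp_infty_comp_of_periodic (z := fun i : ℤ => (x (i - 1), x i)) hcont
    (fun z => d2_add_one (d1_add_one hh.periodic) z.1 z.2)
    fun i => by simpa using hK (i - 1)).neg

theorem memℓp_onDiag (hh : IsEnergy h) (hK : ∀ n, |x (n + 1) - x n| ≤ K) :
    Memℓp (onDiag h x) ∞ := by
  have hcont₁ : Continuous (fun z : ℝ × ℝ => d11 h z.1 z.2) :=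
    (FK.contDiff_d1 (m := 0) hh.contDiff_d1 (by norm_num)).continuous
  have hcont₂ : Continuous (fun z : ℝ × ℝ => d22 h z.1 z.2) :=
    (FK.contDiff_d2 (m := 0) hh.contDiff_d2 (by norm_num)).continuous
  have hmem₁ := memℓp_infty_comp_of_periodic (z := fun i : ℤ => (x i, x (i + 1))) hcont₁
    (fun z => d1_add_one (d1_add_one hh.periodic) z.1 z.2) hK
  have hmem₂ := memℓp_infty_comp_of_periodic (z := fun i : ℤ => (x (i - 1), x i)) hcont₂
    (fun z => d2_add_one (d2_add_one hh.periodic) z.1 z.2) fun i => by simpa using hK (i - 1)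
  exact hmem₂.neg.sub hmem₁

theorem exists_field_linearization_le (hh : IsEnergy h) (F : ℝ)
    (hK : ∀ n, |x (n + 1) - x n| ≤ K) {δ : ℝ} (hδ : 0 < δ) :
    ∃ r > 0, ∀ (z : State) (i : ℤ),
      |z (i - 1) - x (i - 1)| ≤ r → |z i - x i| ≤ r → |z (i + 1) - x (i + 1)| ≤ r →
      |field h F z i - field h F x i - jacobi (offDiag h x) (onDiag h x) (z - x) i| ≤
        δ * (|z (i - 1) - x (i - 1)| + |z i - x i| + |z (i + 1) - x (i + 1)|) := by
  obtain ⟨r₁, hr₁, hlin₁⟩ := exists_linearization_le_of_periodic hh.contDiff_d1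
    (fun z => d1_add_one hh.periodic z.1 z.2) K (half_pos hδ)
  obtain ⟨r₂, hr₂, hlin₂⟩ := exists_linearization_le_of_periodic hh.contDiff_d2
    (fun z => d2_add_one hh.periodic z.1 z.2) K (half_pos hδ)
  refine ⟨min r₁ r₂, lt_min hr₁ hr₂, fun z i hpred hi hsucc => ?_⟩
  have hd1 := hlin₁ (x i, x (i + 1)) (z i, z (i + 1)) (hK i)
    (max_le hi hsucc |>.trans (min_le_left _ _))
  have hd2 := hlin₂ (x (i - 1), x i) (z (i - 1), z i) (by simpa using hK (i - 1))
    (max_le hpred hi |>.trans (min_le_right _ _))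
  rw [fderiv_apply_eq_d1_add_d2 hh.contDiff_d1 one_ne_zero] at hd1
  rw [fderiv_apply_eq_d1_add_d2 hh.contDiff_d2 one_ne_zero, d1_d2_eq_d12 hh.contDiff] at hd2
  simp only [Real.norm_eq_abs, Prod.mk_sub_mk] at hd1 hd2
  have hsup (a b : ℝ) : δ / 2 * ‖(a, b)‖ ≤ δ / 2 * (|a| + |b|) := by
    gcongr
    exact max_le_add_of_nonneg (abs_nonneg a) (abs_nonneg b)
  obtain ⟨hd1l, hd1r⟩ := abs_le.1 (hd1.trans (hsup _ _))
  obtain ⟨hd2l, hd2r⟩ := abs_le.1 (hd2.trans (hsup _ _))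
  have hpred0 := mul_nonneg hδ.le (abs_nonneg (z (i - 1) - x (i - 1)))
  have hsucc0 := mul_nonneg hδ.le (abs_nonneg (z (i + 1) - x (i + 1)))
  simp only [field, jacobi, offDiag, onDiag, d11, d22, Pi.sub_apply, add_sub_cancel_right]
  simp only [d12] at hd2l hd2r ⊢
  rw [abs_le]
  constructor <;> linarith

theorem strictAnti_d1 (hh : IsEnergy h) (y : ℝ) : StrictAnti (d1 h y) := by
  obtain ⟨c, hc, htwist⟩ := hh.twist
  exact strictAnti_of_deriv_neg fun y' => (htwist y y').trans_lt (neg_neg_of_pos hc)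

theorem strictAnti_d2 (hh : IsEnergy h) (y' : ℝ) : StrictAnti fun y => d2 h y y' := by
  obtain ⟨c, hc, htwist⟩ := hh.twist
  exact strictAnti_of_deriv_neg fun y =>
    ((d1_d2_eq_d12 hh.contDiff y y').trans_le (htwist y y')).trans_lt (neg_neg_of_pos hc)

theorem neighbors_eq_of_field_le (hh : IsEnergy h) (hle : z ≤ x) {i : ℤ} (hi : z i = x i)
    (hfield : field h F x i ≤ field h F z i) :
    z (i - 1) = x (i - 1) ∧ z (i + 1) = x (i + 1) := by
  have hd2 := (hh.strictAnti_d2 (x i)).antitone (hle (i - 1))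
  have hd1 := (hh.strictAnti_d1 (x i)).antitone (hle (i + 1))
  unfold field at hfield
  rw [hi] at hfield
  exact ⟨(hh.strictAnti_d2 (x i)).injective (le_antisymm (by linarith) hd2),
    (hh.strictAnti_d1 (x i)).injective (by linarith)⟩

theorem forall_lt_of_field_le (hh : IsEnergy h) (hlt : z < x)
    (hfield : ∀ i, field h F x i ≤ field h F z i) (n : ℤ) : z n < x n := by
  refine lt_of_le_of_ne (hlt.le n) fun hn => hlt.ne (funext fun m => ?_)
  induction m using Int.inductionOn' (b := n) with
  | zero => exact hn
  | succ k _ ih => exact (hh.neighbors_eq_of_field_le hlt.le ih (hfield k)).2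
  | pred k _ ih => exact (hh.neighbors_eq_of_field_le hlt.le ih (hfield k)).1

end IsEnergy

end Linearization

section OrderedCircles

variable {ℓ : Set State} {x y : State}

theorem weight_pos (n : ℤ) : 0 < weight n := by
  unfold weight
  positivity

theorem sub_mem_X (hx : x ∈ X) (hy : y ∈ X) : x - y ∈ X := by
  refine Summable.of_nonneg_of_le (fun n => mul_nonneg (weight_pos n).le (abs_nonneg _))
    (fun n => ?_) (Summable.add hx hy)
  rw [← mul_add]
  exact mul_le_mul_of_nonneg_left (abs_sub _ _) (weight_pos n).le

theorem abs_apply_le_normX (hx : x ∈ X) (n : ℤ) : |x n| ≤ (weight n)⁻¹ * normX x := by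
  rw [le_inv_mul_iff₀ (weight_pos n)]
  exact Summable.le_tsum hx n fun j _ => mul_nonneg (weight_pos j).le (abs_nonneg _)

theorem continuous_of_tendsto_normX {τ : ℝ → State} (hX : ∀ s, τ s ∈ X)
    (hτ : ∀ s, Tendsto (fun r => normX (τ r - τ s)) (𝓝 s) (𝓝 0)) : Continuous τ := by
  refine continuous_pi fun n => continuous_iff_continuousAt.2 fun s => ?_
  refine tendsto_iff_norm_sub_tendsto_zero.2 <| squeeze_zero (fun _ => norm_nonneg _)
    (fun r => abs_apply_le_normX (sub_mem_X (hX r) (hX s)) n) ?_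
  simpa using (hτ s).const_mul (weight n)⁻¹

theorem IsOrderedCircle.exists_param (hℓ : IsOrderedCircle ℓ) :
    ∃ τ : ℝ → State, StrictMono τ ∧ Continuous τ ∧ (∀ (s : ℝ) (k : ℤ), τ (s + k) = τ s + k) ∧
      ℓ = Set.range τ := by
  obtain ⟨τ, hX, hτ, hmono, hone, rfl⟩ := hℓ
  let f : AddConstMap ℝ State 1 1 := ⟨τ, hone⟩
  exact ⟨τ, fun s t => hmono s t, continuous_of_tendsto_normX hX hτ,
    AddConstMapClass.map_add_int f, rfl⟩

theorem eventually_forall_abs_sub_le {τ : ℝ → State} (hτ : Continuous τ) {S : Set ℤ}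
    (hS : S.Finite) {r : ℝ} (hr : 0 < r) (s : ℝ) :
    ∀ᶠ t in 𝓝 s, ∀ n ∈ S, |τ t n - τ s n| ≤ r := by
  refine (eventually_all_finite hS).2 fun n _ => ?_
  exact (Metric.tendsto_nhds.1 ((continuous_apply n).comp hτ).continuousAt r hr).mono
    fun t ht => ht.le

theorem IsOrderedCircle.exists_lt_forall_abs_sub_le (hℓ : IsOrderedCircle ℓ) (hx : x ∈ ℓ)
    {S : Set ℤ} (hS : S.Finite) {r : ℝ} (hr : 0 < r) :
    ∃ z ∈ ℓ, z < x ∧ ∀ n ∈ S, |z n - x n| ≤ r := by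
  obtain ⟨τ, hmono, hτ, -, rfl⟩ := hℓ.exists_param
  obtain ⟨s, rfl⟩ := hx
  obtain ⟨t, hclose, hts⟩ := ((eventually_forall_abs_sub_le hτ hS hr s).filter_mono
    (nhdsWithin_le_nhds (s := Set.Iio s)) |>.and self_mem_nhdsWithin).exists
  exact ⟨τ t, ⟨t, rfl⟩, hmono hts, hclose⟩

theorem IsOrderedCircle.exists_mem_Ioc_abs_sub_le (hℓ : IsOrderedCircle ℓ) (hx : x ∈ ℓ)
    (hy : y ∈ ℓ) (hxy : x < y) (hlim : Tendsto (y - x) cofinite (𝓝 0)) {r : ℝ} (hr : 0 < r) :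
    ∃ z ∈ ℓ, z ∈ Set.Ioc x y ∧ ∀ n, |z n - x n| ≤ r := by
  obtain ⟨τ, hmono, hτ, -, rfl⟩ := hℓ.exists_param
  obtain ⟨s, rfl⟩ := hx
  obtain ⟨t, rfl⟩ := hy
  have hfar : {n | r ≤ |τ t n - τ s n|}.Finite := by
    simpa only [eventually_cofinite, Pi.sub_apply, dist_zero_right, Real.norm_eq_abs, not_lt] using
      Metric.tendsto_nhds.1 hlim r hr
  obtain ⟨a, hclose, hsa, hat⟩ := ((eventually_forall_abs_sub_le hτ hfar hr s).filter_mono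
    (nhdsWithin_le_nhds (s := Set.Ioi s)) |>.and
      (Ioo_mem_nhdsGT (hmono.lt_iff_lt.1 hxy))).exists
  refine ⟨τ a, ⟨a, rfl⟩, ⟨hmono hsa, (hmono hat).le⟩, fun n => ?_⟩
  rcases le_or_gt r |τ t n - τ s n| with hn | hn
  · exact hclose n hn
  · have hsa' := (hmono hsa).le n
    have hat' := (hmono hat).le n
    exact (abs_le_abs_of_nonneg (by linarith) (by linarith)).trans hn.le

end OrderedCircles

section Translations

variable {ℓ : Set State} {x : State} {ω : ℝ}

theorem T_strictMono (q p : ℤ) : StrictMono (T q p) := by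
  refine Monotone.strictMono_of_injective (fun x y hxy n => add_le_add_left (hxy _) _)
    fun x y hxy => funext fun n => ?_
  simpa [T] using congrFun hxy (n + q)

theorem T_neg_T (q p : ℤ) (x : State) : T (-q) (-p) (T q p x) = x := by
  ext n
  simp [T]

theorem IsTOC.T_mem (hℓ : IsTOC ℓ) (hx : x ∈ ℓ) (q p : ℤ) : T q p x ∈ ℓ :=
  hℓ.2 q p ▸ Set.mem_image_of_mem _ hx

theorem IsTOC.exists_forall_sub_mem_Icc (hℓ : IsTOC ℓ) (hx : x ∈ ℓ) (n : ℤ) :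
    ∃ m : ℤ, ∀ j, x (j + n) - x j ∈ Set.Icc (m : ℝ) (m + 1) := by
  have hmem := hℓ.T_mem hx (-n) 0
  obtain ⟨τ, hmono, -, hshift, rfl⟩ := hℓ.1.exists_param
  obtain ⟨s, rfl⟩ := hx
  obtain ⟨t, ht⟩ := hmem
  refine ⟨⌊t - s⌋, fun j => ?_⟩
  have hj : τ t j = τ s (j + n) := by simp [ht, T]
  have hlower := hmono.monotone (by linarith [Int.floor_le (t - s)] : s + ⌊t - s⌋ ≤ t) j
  have hupper := hmono.monotone
    (by push_cast; linarith [Int.lt_floor_add_one (t - s)] : t ≤ s + (⌊t - s⌋ + 1 : ℤ)) j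
  rw [hshift, Pi.add_apply, Pi.intCast_apply, hj] at hlower hupper
  push_cast at hupper
  constructor <;> linarith

theorem HasMeanSpacing.tendsto_natCast_mul (hω : HasMeanSpacing x ω) (n : ℤ) :
    Tendsto (fun k : ℕ => (x (k * n) - x 0) / k) atTop (𝓝 (n * ω)) := by
  have hdiv (k : ℕ) (hn : n ≠ 0) :
      (x (k * n) - x 0) / k = n * ((x (k * n) - x 0) / ((k * n : ℤ) : ℝ)) := by
    have : (n : ℝ) ≠ 0 := Int.cast_ne_zero.2 hn
    push_cast
    field_simp
  rcases lt_trichotomy n 0 with hn | rfl | hn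
  · simp only [hdiv _ hn.ne]
    exact (hω.2.comp (tendsto_natCast_atTop_atTop.atTop_mul_const_of_neg' hn)).const_mul _
  · simp
  · simp only [hdiv _ hn.ne']
    exact (hω.1.comp (tendsto_natCast_atTop_atTop.atTop_mul_const' hn)).const_mul _

theorem HasMeanSpacing.mul_mem_Icc (hω : HasMeanSpacing x ω) {n : ℤ} {a b : ℝ}
    (hn : ∀ j, x (j + n) - x j ∈ Set.Icc a b) : n * ω ∈ Set.Icc a b := by
  have hsum (k : ℕ) : x (k * n) - x 0 ∈ Set.Icc (k * a) (k * b) := by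
    induction k with
    | zero => simp
    | succ k ih =>
      have := hn (k * n)
      push_cast [add_one_mul]
      exact ⟨by linarith [ih.1, this.1], by linarith [ih.2, this.2]⟩
  refine isClosed_Icc.mem_of_tendsto (hω.tendsto_natCast_mul n) <|
    (eventually_gt_atTop 0).mono fun k hk => ?_
  have hk' : (0 : ℝ) < k := Nat.cast_pos.2 hk
  exact ⟨(le_div_iff₀' hk').2 (hsum k).1, (div_le_iff₀' hk').2 (hsum k).2⟩

theorem IsTOC.abs_sub_sub_mul_le (hℓ : IsTOC ℓ) (hx : x ∈ ℓ) (hω : HasMeanSpacing x ω)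
    (n j : ℤ) : |x (j + n) - x j - n * ω| ≤ 1 := by
  obtain ⟨m, hm⟩ := hℓ.exists_forall_sub_mem_Icc hx n
  obtain ⟨hl, hr⟩ := hm j
  obtain ⟨hl', hr'⟩ := hω.mul_mem_Icc hm
  exact abs_le.2 ⟨by linarith, by linarith⟩

theorem IsTOC.abs_add_one_sub_le (hℓ : IsTOC ℓ) (hx : x ∈ ℓ) (hω : HasMeanSpacing x ω)
    (n : ℤ) : |x (n + 1) - x n| ≤ 1 + |ω| := by
  have := hℓ.abs_sub_sub_mul_le hx hω 1 n
  rw [Int.cast_one, one_mul] at this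
  linarith [abs_sub_abs_le_abs_sub (x (n + 1) - x n) ω]

end Translations

section Summability

theorem summable_add_one_sub_of_monotone {g : ℤ → ℝ} (hg : Monotone g) {B : ℝ}
    (hB : ∀ n, |g n| ≤ B) : Summable fun n => g (n + 1) - g n := by
  have hnonneg (n : ℤ) : 0 ≤ g (n + 1) - g n := sub_nonneg.2 (hg (by lia))
  have hdiff (m n : ℤ) : g m - g n ≤ B + B :=
    (le_abs_self _).trans ((abs_sub _ _).trans (add_le_add (hB m) (hB n)))
  refine .of_nat_of_neg
    (summable_of_sum_range_le (c := B + B) (fun n => hnonneg n) fun N => ?_)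
    (summable_of_sum_range_le (c := B + B) (fun n => hnonneg (-n)) fun N => ?_)
  · exact_mod_cast (Finset.sum_range_sub (fun n : ℕ => g n) N).trans_le (hdiff _ _)
  · have htele (n : ℕ) : g (-n + 1) - g (-n) = g (1 - n) - g (1 - (n + 1 : ℕ)) := by
      congr 2 <;> push_cast <;> ring
    simp only [htele, Finset.sum_range_sub' (fun n : ℕ => g (1 - n))]
    exact hdiff _ _

theorem summable_add_natCast_sub_of_le {e : ℤ → ℝ} {q : ℕ} (he : ∀ n, e n ≤ e (n + q)) {B : ℝ}
    (hB : ∀ n, |e n| ≤ B) : Summable fun n => e (n + q) - e n := by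
  set g : ℤ → ℝ := fun n => ∑ j ∈ Finset.range q, e (n + j)
  have hstep (n : ℤ) : g (n + 1) - g n = e (n + q) - e n := by
    rw [← Finset.sum_sub_distrib]
    have := Finset.sum_range_sub (fun j : ℕ => e (n + j)) q
    simp only [Nat.cast_add, Nat.cast_one, Nat.cast_zero, add_zero] at this
    rw [← this]
    exact Finset.sum_congr rfl fun j _ => by rw [add_right_comm, add_assoc]
  simp only [← hstep]
  refine summable_add_one_sub_of_monotone (B := q * B)
    (monotone_int_of_le_succ fun n => ?_) fun n => ?_
  · exact sub_nonneg.1 ((sub_nonneg.2 (he n)).trans_eq (hstep n).symm)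
  · refine (Finset.abs_sum_le_sum_abs _ _).trans ((Finset.sum_le_card_nsmul _ _ B ?_).trans_eq ?_)
    · exact fun j _ => hB _
    · simp

theorem IsTOC.summable_T_neg_sub {ℓ : Set State} {x : State} (hℓ : IsTOC ℓ) (hx : x ∈ ℓ) {p : ℤ}
    {q : ℕ} (hq : 0 < q) (hω : HasMeanSpacing x (p / q)) (hle : x ≤ T (-q) (-p) x) :
    Summable (T (-q) (-p) x - x) := by
  have hstep (n : ℤ) : x (n + q) - (n + q : ℤ) * (p / q : ℝ) - (x n - n * (p / q : ℝ)) =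
      (T (-q) (-p) x - x) n := by
    simp only [T, Pi.sub_apply, sub_neg_eq_add]
    push_cast
    field_simp
    ring
  have hbdd (n : ℤ) : |x n - n * (p / q : ℝ)| ≤ |x 0| + 1 := by
    have := hℓ.abs_sub_sub_mul_le hx hω n 0
    rw [zero_add, sub_right_comm] at this
    linarith [abs_sub_abs_le_abs_sub (x n - n * (p / q : ℝ)) (x 0)]
  have := summable_add_natCast_sub_of_le (e := fun n => x n - n * (p / q : ℝ)) (q := q)
    (fun n => sub_nonneg.1 ((sub_nonneg.2 (hle n)).trans_eq (hstep n).symm)) hbdd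
  simpa only [hstep] using this

end Summability

section Degeneracy

variable {h : ℝ → ℝ → ℝ} {F K : ℝ} {ℓ : Set State} {x y z : State}

namespace IsEnergy

theorem exists_supersolution (hh : IsEnergy h) (hℓ : IsOrderedCircle ℓ)
    (hmono : ∀ z ∈ ℓ, ∀ n, 0 ≤ field h F z n) (hx : x ∈ ℓ) (heq : IsEquilibrium h F x)
    (hK : ∀ n, |x (n + 1) - x n| ≤ K) {S : Set ℤ} (hS : S.Finite) {δ : ℝ} (hδ : 0 < δ) :
    ∃ u : ℤ → ℝ, (∀ i, 0 < u i) ∧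
      ∀ i ∈ S, jacobi (offDiag h x) (onDiag h x) u i ≤ δ * jacobi 1 1 u i := by
  obtain ⟨r, hr, hlin⟩ := hh.exists_field_linearization_le F hK hδ
  have hnear : ((fun i => i - 1) '' S ∪ S ∪ (fun i => i + 1) '' S).Finite :=
    ((hS.image _).union hS).union (hS.image _)
  obtain ⟨z, hz, hzx, hclose⟩ := hℓ.exists_lt_forall_abs_sub_le hx hnear hr
  have hlt := hh.forall_lt_of_field_le hzx fun i => (heq i).trans_le (hmono z hz i)
  refine ⟨x - z, fun i => sub_pos.2 (hlt i), fun i hi => ?_⟩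
  have hlin := hlin z i (hclose _ (.inl (.inl ⟨i, hi, rfl⟩))) (hclose _ (.inl (.inr hi)))
    (hclose _ (.inr ⟨i, hi, rfl⟩))
  rw [heq i, abs_le, abs_sub_comm, abs_of_pos (sub_pos.2 (hlt _)), abs_sub_comm,
    abs_of_pos (sub_pos.2 (hlt _)), abs_sub_comm, abs_of_pos (sub_pos.2 (hlt _))] at hlin
  have hfield := hmono z hz i
  simp only [jacobi, Pi.sub_apply, Pi.one_apply, one_mul] at hlin ⊢
  linarith [hlin.2]

theorem exists_subsolution (hh : IsEnergy h) (hℓ : IsOrderedCircle ℓ)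
    (hmono : ∀ z ∈ ℓ, ∀ n, 0 ≤ field h F z n) (hx : x ∈ ℓ) (heq : IsEquilibrium h F x)
    (hK : ∀ n, |x (n + 1) - x n| ≤ K) (hy : y ∈ ℓ) (hxy : x < y) (hsum : Summable (y - x))
    {δ : ℝ} (hδ : 0 < δ) :
    ∃ w : Ell2, w ≠ 0 ∧ (∀ i, 0 ≤ w i) ∧
      ∀ i, -(δ * jacobi 1 1 w i) ≤ jacobi (offDiag h x) (onDiag h x) w i := by
  obtain ⟨r, hr, hlin⟩ := hh.exists_field_linearization_le F hK hδ
  obtain ⟨z, hz, ⟨hxz, hzy⟩, hclose⟩ :=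
    hℓ.exists_mem_Ioc_abs_sub_le hx hy hxy hsum.tendsto_cofinite_zero hr
  have hnonneg (i : ℤ) : 0 ≤ z i - x i := sub_nonneg.2 (hxz.le i)
  have hmem_one : Memℓp (y - x) 1 := memℓp_gen (by simpa using hsum.abs)
  have hmem : Memℓp (z - x) 2 := (hmem_one.of_exponent_ge one_le_two).mono' fun i => by
    simpa only [Pi.sub_apply, Real.norm_eq_abs] using
      abs_le_abs_of_nonneg (hnonneg i) (sub_le_sub_right (hzy i) _)
  refine ⟨⟨z - x, hmem⟩, fun h0 => hxz.ne' (sub_eq_zero.1 (congrArg Subtype.val h0)), hnonneg,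
    fun i => ?_⟩
  have hlin := hlin z i (hclose _) (hclose _) (hclose _)
  rw [heq i, abs_le, abs_of_nonneg (hnonneg _), abs_of_nonneg (hnonneg _),
    abs_of_nonneg (hnonneg _)] at hlin
  have hfield := hmono z hz i
  simp only [jacobi, Pi.sub_apply, Pi.one_apply, one_mul] at hlin ⊢
  linarith [hlin.2]

theorem isDegenerate_of_summable_sub (hh : IsEnergy h) (hℓ : IsOrderedCircle ℓ)
    (hmono : ∀ z ∈ ℓ, ∀ n, 0 ≤ field h F z n) (hx : x ∈ ℓ) (heq : IsEquilibrium h F x)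
    (hK : ∀ n, |x (n + 1) - x n| ≤ K) (hy : y ∈ ℓ) (hxy : x < y) (hsum : Summable (y - x)) :
    IsDegenerate h x := by
  obtain ⟨c, hc, htwist⟩ := hh.twist
  refine ⟨jacobiOp ⟨offDiag h x, hh.memℓp_offDiag hK⟩ ⟨onDiag h x, hh.memℓp_onDiag hK⟩,
    fun η i => ?_, zero_mem_spectrum_jacobiOp hc (fun i => le_neg_of_le_neg (htwist _ _))
      (fun S hS δ hδ => hh.exists_supersolution hℓ hmono hx heq hK hS hδ)
      (fun δ hδ => hh.exists_subsolution hℓ hmono hx heq hK hy hxy hsum hδ)⟩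
  simp only [jacobiOp_apply, jacobi, offDiag, onDiag, add_sub_cancel_right]

end IsEnergy

end Degeneracy

end FK

theorem mainTheorem7_general (h : ℝ → ℝ → ℝ) (hh : FK.IsEnergy h) (p : ℤ) (q : ℕ) (hq : 0 < q)
    (F : ℝ) (ℓ : Set FK.State) (hℓ : FK.IsTOC ℓ)
    (hmono : ∀ z ∈ ℓ, ∀ n : ℤ, 0 ≤ FK.field h F z n) :
    ∀ x ∈ ℓ, FK.IsEquilibriumPlus h F p q x → FK.IsDegenerate h x := by
  intro x hx ⟨heq, hω, hlt⟩
  have hxy : x < FK.T (-q) (-p) x := by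
    simpa only [FK.T_neg_T] using FK.T_strictMono (-q) (-p) hlt
  exact hh.isDegenerate_of_summable_sub hℓ.1 hmono hx heq (hℓ.abs_add_one_sub_le hx hω)
    (hℓ.T_mem hx _ _) hxy (hℓ.summable_T_neg_sub hx hq hω hxy.le)

theorem mainTheorem7 (h : ℝ → ℝ → ℝ) (hh : FK.IsEnergy h)
    (p : ℤ) (q : ℕ) (hq : 0 < q) (hpq : IsCoprime p (q : ℤ))
    (F : ℝ)
    (hF₁ : FK.depinningForcePlus h ((p : ℝ) / (q : ℝ)) ≤ F)
    (hF₂ : F < FK.depinningForce h ((p : ℝ) / (q : ℝ)))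
    (ℓ : Set FK.State) (hℓ : FK.IsIOCPlus h F p q ℓ)
    (hmono : ∀ z ∈ ℓ, ∀ n : ℤ, 0 ≤ FK.field h F z n) :
    ∀ x ∈ ℓ, FK.IsEquilibriumPlus h F p q x → FK.IsDegenerate h x :=
  mainTheorem7_general h hh p q hq F ℓ hℓ.1.1 hmono
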